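/- Let $n\ge 0$ and write $\bar x=(x_1,\dots,x_n)$. Let $G_n(\mathbb C)=\mathbb C^n\times(\mathbb C^*)^n$, and let $\pi:G_n(\mathbb C)\to\mathbb C^n$ be the projection onto the first $n$ coordinates. Let $p_1,\dots,p_n\in\mathbb C[\bar x,u]$ be irreducible polynomials, each of degree at least $1$ in $u$ and none of the form $c\,u$ with $c\in\mathbb C$. Let $V\subseteq G_n(\mathbb C)$ be an irreducible component, in the Zariski topology, of the set $$\{(\bar x,\bar y)\in G_n(\mathbb C) : p_i(\bar x,y_i)=0 \text{ for all } i=1,\dots,n\},$$ and assume that $\pi(V)$ is Zariski dense in $\mathbb C^n$. Then the set $$\{\bar a=(a_1,\dots,a_n)\in\mathbb C^n : (\bar a,e^{\bar a})\in V\},\qquad e^{\bar a}=(e^{a_1},\dots,e^{a_n}),$$ is Zariski dense in $\mathbb C^n$. -/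

import Mathlib

/-- The Zariski topology on the affine space `K^σ`: the closed sets are the common zero sets
of sets (equivalently, ideals) of polynomials with coefficients in `K`. -/
@[reducible] def zariskiTopology (σ K : Type*) [Field K] : TopologicalSpace (σ → K) :=
  TopologicalSpace.ofClosed
    {Z | ∃ S : Set (MvPolynomial σ K), Z = {x | ∀ p ∈ S, MvPolynomial.eval x p = 0}}
    ⟨{1}, by ext x; simp⟩
    (by
      intro A hA
      refine ⟨{p | ∃ Z ∈ A, ∀ x ∈ Z, MvPolynomial.eval x p = 0}, ?_⟩
      ext x
      constructor
      · rintro hx p ⟨Z, hZ, hp⟩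
        exact hp x (hx Z hZ)
      · intro hx Z hZ
        obtain ⟨S, hS⟩ := hA hZ
        rw [hS]
        intro p hp
        refine hx p ⟨Z, hZ, fun y hy => ?_⟩
        rw [hS] at hy
        exact hy p hp)
    (by
      rintro A ⟨S, rfl⟩ B ⟨T, rfl⟩
      refine ⟨{r | ∃ p ∈ S, ∃ q ∈ T, r = p * q}, ?_⟩
      ext x
      constructor
      · rintro (hx | hx) r ⟨p, hp, q, hq, rfl⟩
        · rw [map_mul, hx p hp, zero_mul]
        · rw [map_mul, hx q hq, mul_zero]
      · intro hx
        by_contra hcon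
        simp only [Set.mem_union, Set.mem_ofPred_eq, not_or, not_forall] at hcon
        obtain ⟨⟨p, hp, hp0⟩, ⟨q, hq, hq0⟩⟩ := hcon
        have h := hx (p * q) ⟨p, hp, q, hq, rfl⟩
        rw [map_mul] at h
        exact (mul_ne_zero hp0 hq0) h)

/-- A subset of `ℂ^n` is Zariski dense if its closure in the Zariski topology is `ℂ^n`. -/
def ZariskiDense {n : ℕ} (s : Set (Fin n → ℂ)) : Prop :=
  @Dense (Fin n → ℂ) (zariskiTopology (Fin n) ℂ) s

/-- The points of the algebraic group `G_n(ℂ) = ℂ^n × (ℂ^*)^n`. -/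
abbrev GPoints (n : ℕ) : Type := (Fin n → ℂ) × (Fin n → ℂˣ)

/-- The inclusion of `G_n(ℂ)` in the affine space `ℂ^(2n)`. -/
def GPoints.toAffine {n : ℕ} (g : GPoints n) : Fin n ⊕ Fin n → ℂ :=
  Sum.elim g.1 (fun i => (g.2 i : ℂ))

/-- The Zariski topology on `G_n(ℂ)`, as an open subvariety of `ℂ^(2n)`. It is kept apart from
the Euclidean topology, which is the one found by instance search. -/
@[reducible] noncomputable def zariskiTopologyG (n : ℕ) : TopologicalSpace (GPoints n) :=
  (zariskiTopology (Fin n ⊕ Fin n) ℂ).induced GPoints.toAffine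

/-- `V` is an irreducible component of the subset `S` of `G_n(ℂ)`: a maximal element among the
subsets of `S` that are irreducible (in particular nonempty) in the Zariski topology. -/
def IsIrreducibleComponentOf {n : ℕ} (V S : Set (GPoints n)) : Prop :=
  Maximal (fun Z : Set (GPoints n) => Z ⊆ S ∧ @IsIrreducible (GPoints n) (zariskiTopologyG n) Z) V

/-- The value `p(a, b)` of a polynomial `p ∈ ℂ[x₁, …, xₙ][u]` at `x = a`, `u = b`. -/
noncomputable def evalAt {n : ℕ} (p : Polynomial (MvPolynomial (Fin n) ℂ))
    (a : Fin n → ℂ) (b : ℂ) : ℂ :=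
  (p.map (MvPolynomial.eval a)).eval b

/-- The set of `(x, y) ∈ G_n(ℂ)` with `p_i(x, y_i) = 0` for all `i`. -/
def systemZeros {n : ℕ} (p : Fin n → Polynomial (MvPolynomial (Fin n) ℂ)) : Set (GPoints n) :=
  {g | ∀ i, evalAt (p i) g.1 (g.2 i : ℂ) = 0}

/-- The point `(a, e^a) = (a₁, …, aₙ, e^{a₁}, …, e^{aₙ})` of `G_n(ℂ)`. -/
noncomputable def expPoint {n : ℕ} (a : Fin n → ℂ) : GPoints n :=
  (a, fun i => Units.mk0 (Complex.exp (a i)) (Complex.exp_ne_zero (a i)))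

/-! Since `V` dominates `ℂ^n` and each `y_i` is algebraic over `ℂ(x)`, the field generated by the
`y_i` over `ℂ(x)` is finite. It has a primitive element `θ` integral over `ℂ[x]`, with monic minimal
polynomial `m`, and `y_i = H_i(θ)/d`, `1/y_i = H'_i(θ)/d` for one denominator `d`. Away from `d = 0`
the roots of `m` are simple and each root gives a point of `V` (`exists_generic_parametrization`).
It remains to solve `exp x_i = y_i(x)` outside any hypersurface `q = 0`.

Choose `v` in `(2πiℤ)^n` at which the leading form of `d * q` does not vanish. On the ball of radius
`c t` about `t v`, `t` large, `|d q|` is bounded below. The ball is convex, so a holomorphic root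
`θ` and holomorphic logarithms `l_i` of `y_i` exist there (`exists_smooth_root`,
`exists_smooth_log`). As `y_i` and `1/y_i` grow at most polynomially, `Re l_i = O(log t)`, whereas
the radius is linear in `t`. By Borel–Carathéodory `l` has Lipschitz constant `O(log t / t)` on a
smaller ball, and a contraction gives the solution (`exists_exp_eq_exp_mul_exp`); the centre
disappears because `exp (t v) = 1` for `t ∈ ℕ`. -/

/-! ### Algebra: parametrizing the variety by a root of a monic polynomial. -/

open Polynomial IntermediateField in
/-- A finite extension of the fraction field of a domain of characteristic zero is generated by an
integral element; every element is, up to a denominator, a polynomial in the generator. -/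
theorem exists_integral_generator (R F L : Type*) [CommRing R] [IsDomain R] [Field F] [Algebra R F]
    [IsFractionRing R F] [Field L] [Algebra F L] [Algebra R L] [IsScalarTower R F L]
    [FiniteDimensional F L] [CharZero F] :
    ∃ θ : L, IsIntegral R θ ∧
      ∀ z : L, ∃ d : R, d ≠ 0 ∧ ∃ H : R[X], algebraMap R L d * z = aeval θ H := by
  obtain ⟨θ₀, hθ₀⟩ := Field.exists_primitive_element F L
  have halg : IsAlgebraic R θ₀ :=
    (IsFractionRing.isAlgebraic_iff R F L).2 (Algebra.IsAlgebraic.isAlgebraic θ₀)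
  obtain ⟨c, hc, hint⟩ := halg.exists_integral_multiple
  refine ⟨c • θ₀, hint, fun z => ?_⟩
  have hz : z ∈ Algebra.adjoin F {θ₀} := by
    rw [← IntermediateField.adjoin_simple_toSubalgebra_of_isAlgebraic
      (Algebra.IsAlgebraic.isAlgebraic θ₀), hθ₀]
    trivial
  -- The factor `c` is a unit of `F`, so making the generator integral does not change the algebra
  -- it generates.
  have hle : Algebra.adjoin F {θ₀} ≤ Algebra.adjoin F {c • θ₀} := by
    rw [Algebra.adjoin_le_iff, Set.singleton_subset_iff]
    have h := Subalgebra.smul_mem (Algebra.adjoin F {c • θ₀})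
      (Algebra.subset_adjoin (Set.mem_singleton (c • θ₀))) (algebraMap R F c)⁻¹
    have hcF : algebraMap R F c ≠ 0 := by
      rwa [Ne, map_eq_zero_iff _ (IsFractionRing.injective R F)]
    rwa [← algebraMap_smul F c θ₀, smul_smul, inv_mul_cancel₀ hcF, one_smul,
      algebraMap_smul] at h
  have hz' := hle hz
  rw [Algebra.adjoin_singleton_eq_range_aeval] at hz'
  obtain ⟨h, rfl⟩ := hz'
  obtain ⟨b, hb, hbh⟩ := IsLocalization.integerNormalization_spec (nonZeroDivisors R) h
  refine ⟨b, nonZeroDivisors.ne_zero hb, IsLocalization.integerNormalization (nonZeroDivisors R) h, ?_⟩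
  rw [← Polynomial.aeval_map_algebraMap F, hbh, ← algebraMap_smul F b h, map_smul]
  rw [algebraMap_smul]
  exact (Algebra.smul_def _ _).symm

open Polynomial in
theorem exists_common_denominator {R L ι : Type*} [CommRing R] [IsDomain R] [Field L] [Algebra R L]
    [Fintype ι] (θ : L)
    (hθ : ∀ z : L, ∃ d : R, d ≠ 0 ∧ ∃ H : R[X], algebraMap R L d * z = aeval θ H) (z : ι → L) :
    ∃ d : R, d ≠ 0 ∧ ∃ H : ι → R[X], ∀ i, algebraMap R L d * z i = aeval θ (H i) := by
  classical
  choose d hd H hH using fun i => hθ (z i)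
  refine ⟨∏ i, d i, Finset.prod_ne_zero_iff.2 fun i _ => hd i,
    fun i => C (∏ j ∈ Finset.univ.erase i, d j) * H i, fun i => ?_⟩
  rw [← Finset.prod_erase_mul _ _ (Finset.mem_univ i), map_mul, mul_assoc, hH, map_mul, aeval_C]

open Polynomial in
/-- The minimal polynomial of an integral element is separable away from a hypersurface. -/
theorem exists_bezout_derivative_minpoly (R F : Type*) {L : Type*} [CommRing R] [IsDomain R]
    [IsIntegrallyClosed R] [Field F] [Algebra R F] [IsFractionRing R F] [Field L] [Algebra F L]
    [Algebra R L] [IsScalarTower R F L] [CharZero F] {θ : L} (hθ : IsIntegral R θ) :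
    ∃ e : R, e ≠ 0 ∧ ∃ a b : R[X],
      a * minpoly R θ + b * derivative (minpoly R θ) = C e := by
  have hsep : (minpoly F θ).Separable :=
    (minpoly.irreducible (hθ.tower_top (A := F))).separable
  obtain ⟨a, b, hab⟩ := hsep
  -- Gauss's lemma: the minimal polynomial over `F` already has coefficients in `R`, so only the
  -- Bézout coefficients need their denominators cleared.
  rw [minpoly.isIntegrallyClosed_eq_field_fractions' F hθ, derivative_map] at hab
  obtain ⟨u, hu, hua⟩ := IsLocalization.integerNormalization_spec (nonZeroDivisors R) a
  obtain ⟨v, hv, hvb⟩ := IsLocalization.integerNormalization_spec (nonZeroDivisors R) b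
  refine ⟨u * v, mul_ne_zero (nonZeroDivisors.ne_zero hu) (nonZeroDivisors.ne_zero hv),
    C v * IsLocalization.integerNormalization (nonZeroDivisors R) a,
    C u * IsLocalization.integerNormalization (nonZeroDivisors R) b, ?_⟩
  apply Polynomial.map_injective _ (IsFractionRing.injective R F)
  rw [← algebraMap_smul F, Polynomial.smul_eq_C_mul] at hua hvb
  simp only [Polynomial.map_add, Polynomial.map_mul, hua, hvb, Polynomial.map_C, map_mul]
  linear_combination (C (algebraMap R F u) * C (algebraMap R F v)) * hab

/-- The value at `(x, T)` of a polynomial in one variable over `ℂ[x]`. -/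
noncomputable abbrev evalPair {σ : Type*} (x : σ → ℂ) (T : ℂ) :
    Polynomial (MvPolynomial σ ℂ) →+* ℂ :=
  Polynomial.eval₂RingHom (MvPolynomial.eval x) T

open Polynomial in
/-- Clearing denominators in a polynomial expression in `x` and in fractions `y = H(θ) / d`. -/
theorem exists_clear_denominators {σ τ L : Type*} [Field L] [Algebra (MvPolynomial σ ℂ) L]
    {θ : L} {y : τ → L} {d : MvPolynomial σ ℂ} {H : τ → (MvPolynomial σ ℂ)[X]}
    (hH : ∀ i, algebraMap _ L d * y i = aeval θ (H i)) (f : MvPolynomial (σ ⊕ τ) ℂ) :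
    ∃ (N : ℕ) (G : (MvPolynomial σ ℂ)[X]),
      algebraMap _ L d ^ N *
        MvPolynomial.eval₂ ((algebraMap (MvPolynomial σ ℂ) L).comp MvPolynomial.C)
          (Sum.elim (fun i => algebraMap (MvPolynomial σ ℂ) L (MvPolynomial.X i)) y) f = aeval θ G ∧
      ∀ x T, MvPolynomial.eval x d ≠ 0 →
        MvPolynomial.eval x d ^ N * MvPolynomial.eval
          (Sum.elim x fun i => evalPair x T (H i) / MvPolynomial.eval x d) f = evalPair x T G := by
  induction f using MvPolynomial.induction_on with
  | C a => exact ⟨0, C (MvPolynomial.C a), by simp, fun x T _ => by simp⟩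
  | add f g hf hg =>
    obtain ⟨N, F, hF, hF'⟩ := hf
    obtain ⟨M, G, hG, hG'⟩ := hg
    refine ⟨N + M, C d ^ M * F + C d ^ N * G, ?_, fun x T hx => ?_⟩
    · simp only [map_add, map_mul, map_pow, aeval_C, ← hF, ← hG, MvPolynomial.eval₂_add]
      ring
    · simp only [map_add, map_mul, map_pow, ← hF' x T hx, ← hG' x T hx]
      simp only [coe_eval₂RingHom, eval₂_C]
      ring
  | mul_X f i hf =>
    obtain ⟨N, F, hF, hF'⟩ := hf
    rcases i with i | i
    · refine ⟨N, F * C (MvPolynomial.X i), ?_, fun x T hx => ?_⟩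
      · simp only [map_mul, aeval_C, ← hF, MvPolynomial.eval₂_mul, MvPolynomial.eval₂_X,
          Sum.elim_inl]
        ring
      · simp only [map_mul, ← hF' x T hx, MvPolynomial.eval_X, Sum.elim_inl]
        simp only [coe_eval₂RingHom, eval₂_C, MvPolynomial.eval_X]
        ring
    · refine ⟨N + 1, F * H i, ?_, fun x T hx => ?_⟩
      · simp only [map_mul, ← hF, ← hH, MvPolynomial.eval₂_mul, MvPolynomial.eval₂_X,
          Sum.elim_inr]
        ring
      · simp only [map_mul, ← hF' x T hx, MvPolynomial.eval_X, Sum.elim_inr]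
        field_simp
        ring

open Polynomial in
/-- A prime ideal of `ℂ[x, y]` over the generic point of `x`-space, with `y` algebraic over `x` and
nonzero, has points parametrized by `x` and a root of a monic generically separable polynomial. -/
theorem exists_generic_parametrization_of_field {σ τ K : Type*} [Fintype τ] [Field K]
    (P : Ideal (MvPolynomial (σ ⊕ τ) ℂ)) (φ : MvPolynomial (σ ⊕ τ) ℂ →+* K)
    (hφ : ∀ f, φ f = 0 ↔ f ∈ P)
    (hinj : ∀ f : MvPolynomial σ ℂ, MvPolynomial.rename Sum.inl f ∈ P → f = 0)
    (hy : ∀ i, MvPolynomial.X (Sum.inr i) ∉ P)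
    (halg : ∀ i, ∃ p : (MvPolynomial σ ℂ)[X], p ≠ 0 ∧
      eval₂ (MvPolynomial.rename Sum.inl : MvPolynomial σ ℂ →ₐ[ℂ] _).toRingHom
        (MvPolynomial.X (Sum.inr i)) p ∈ P) :
    ∃ (m : (MvPolynomial σ ℂ)[X]) (d : MvPolynomial σ ℂ) (H H' : τ → (MvPolynomial σ ℂ)[X]),
      m.Monic ∧ m.natDegree ≠ 0 ∧ d ≠ 0 ∧ ∀ x T, evalPair x T m = 0 → MvPolynomial.eval x d ≠ 0 →
        evalPair x T (derivative m) ≠ 0 ∧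
        (∀ i, evalPair x T (H i) * evalPair x T (H' i) = MvPolynomial.eval x d ^ 2) ∧
        ∀ f ∈ P, MvPolynomial.eval
          (Sum.elim x fun i => evalPair x T (H i) / MvPolynomial.eval x d) f = 0 := by
  let R := MvPolynomial σ ℂ
  let ψ : R →+* K := φ.comp (MvPolynomial.rename Sum.inl : R →ₐ[ℂ] _).toRingHom
  let _ : Algebra R K := ψ.toAlgebra
  have hψ : Function.Injective (algebraMap R K) := by
    rw [injective_iff_map_eq_zero]
    intro f hf
    exact hinj f ((hφ _).1 hf)
  have : FaithfulSMul R K := (faithfulSMul_iff_algebraMap_injective R K).2 hψ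
  let F := FractionRing R
  let _ : Algebra F K := FractionRing.liftAlgebra R K
  have : IsScalarTower R F K := FractionRing.isScalarTower_liftAlgebra R K
  have : CharZero R := MvPolynomial.instCharZero σ ℂ
  have : CharZero F := IsFractionRing.charZero_of_isFractionRing R
  let yK : τ → K := fun i => φ (MvPolynomial.X (Sum.inr i))
  have hyK : ∀ i, IsIntegral F (yK i) := fun i => by
    obtain ⟨p, hp, hpP⟩ := halg i
    have h : IsAlgebraic R (yK i) := ⟨p, hp, by
      rw [← (hφ _).2 hpP, hom_eval₂]
      rfl⟩
    exact ((IsFractionRing.isAlgebraic_iff R F K).1 h).isIntegral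
  let L := IntermediateField.adjoin F (Set.range yK)
  have : FiniteDimensional F L :=
    IntermediateField.finiteDimensional_adjoin (by rintro _ ⟨i, rfl⟩; exact hyK i)
  have : IsScalarTower R F L := inferInstance
  have : IsScalarTower R L K := IsScalarTower.of_algebraMap_eq fun r => by
    rw [IsScalarTower.algebraMap_apply R F K, IsScalarTower.algebraMap_apply R F L,
      ← IsScalarTower.algebraMap_apply F L K]
  let y : τ → L := fun i => ⟨yK i, IntermediateField.subset_adjoin F _ ⟨i, rfl⟩⟩
  have hy0 : ∀ i, y i ≠ 0 := fun i h => hy i ((hφ _).1 (congrArg Subtype.val h))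
  have hev : ∀ f ∈ P, MvPolynomial.eval₂ ((algebraMap R L).comp MvPolynomial.C)
      (Sum.elim (fun i => algebraMap R L (MvPolynomial.X i)) y) f = 0 := by
    intro f hf
    apply (algebraMap L K).injective
    rw [map_zero, ← (hφ f).2 hf, MvPolynomial.hom_eval₂]
    have : ∀ g, MvPolynomial.eval₂ ((algebraMap L K).comp ((algebraMap R L).comp MvPolynomial.C))
      (fun i => algebraMap L K (Sum.elim (fun i => algebraMap R L (MvPolynomial.X i)) y i)) g
        = φ g := by
      intro g
      rw [← MvPolynomial.coe_eval₂Hom]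
      refine congrFun (congrArg DFunLike.coe (MvPolynomial.ringHom_ext (fun a => ?_) fun i => ?_)) g
      · simp only [MvPolynomial.coe_eval₂Hom, MvPolynomial.eval₂_C, RingHom.comp_apply,
          ← IsScalarTower.algebraMap_apply R L K]
        change φ (MvPolynomial.rename Sum.inl (MvPolynomial.C a)) = _
        rw [MvPolynomial.rename_C]
      · rcases i with i | i
        · simp only [MvPolynomial.coe_eval₂Hom, MvPolynomial.eval₂_X, Sum.elim_inl,
            ← IsScalarTower.algebraMap_apply R L K]
          change φ (MvPolynomial.rename Sum.inl (MvPolynomial.X i)) = _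
          rw [MvPolynomial.rename_X]
        · simp only [MvPolynomial.coe_eval₂Hom, MvPolynomial.eval₂_X, Sum.elim_inr]
          rfl
    exact this f
  obtain ⟨θ, hθ, hgen⟩ := exists_integral_generator R F L
  obtain ⟨e, he, a, b, hab⟩ := exists_bezout_derivative_minpoly R F hθ
  -- Including the inverses is what later bounds `log |y_i|` from both sides.
  obtain ⟨d₀, hd₀, G, hG⟩ := exists_common_denominator θ hgen (Sum.elim y fun i => (y i)⁻¹)
  set m := minpoly R θ with hm
  have hRL : Function.Injective (algebraMap R L) := by
    rw [IsScalarTower.algebraMap_eq R F L]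
    exact (algebraMap F L).injective.comp (IsFractionRing.injective R F)
  have : FaithfulSMul R L := (faithfulSMul_iff_algebraMap_injective R L).2 hRL
  -- Identities at the generic point specialize: a polynomial killing `θ` is a multiple of `m` over
  -- `R` itself, so it vanishes at every zero of `m`, with no denominator to avoid.
  have hroot : ∀ g : R[X], aeval θ g = 0 → ∀ x T, evalPair x T m = 0 → evalPair x T g = 0 := by
    intro g hg x T hx
    obtain ⟨q, rfl⟩ := minpoly.isIntegrallyClosed_dvd hθ hg
    rw [map_mul, hx, zero_mul]
  -- The factor `e` makes the roots of `m` simple wherever `d` is nonzero; the numerators are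
  -- rescaled to match.
  let d := d₀ * e
  let H : τ ⊕ τ → R[X] := fun i => C e * G i
  have hH : ∀ i, algebraMap R L d * Sum.elim y (fun i => (y i)⁻¹) i = aeval θ (H i) := fun i => by
    simp only [d, H, map_mul, aeval_C, ← hG]
    ring
  refine ⟨m, d, fun i => H (Sum.inl i), fun i => H (Sum.inr i), minpoly.monic hθ,
    (minpoly.natDegree_pos hθ).ne', mul_ne_zero hd₀ he, fun x T hx hdx => ⟨fun h0 => ?_, fun i => ?_,
    fun f hf => ?_⟩⟩
  · have h := congrArg (evalPair x T) hab
    simp only [map_add, map_mul, hx, h0, mul_zero, add_zero] at h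
    simp only [coe_eval₂RingHom, eval₂_C] at h
    rw [map_mul, ← h, mul_zero] at hdx
    exact hdx rfl
  · have h : aeval θ (H (Sum.inl i) * H (Sum.inr i) - C d ^ 2) = 0 := by
      simp only [map_sub, map_mul, map_pow, aeval_C, ← hH, Sum.elim_inl, Sum.elim_inr]
      field_simp [hy0 i]
      ring
    have h := hroot _ h x T hx
    rw [map_sub, sub_eq_zero, map_mul, map_pow] at h
    rw [h, coe_eval₂RingHom, eval₂_C]
  · obtain ⟨N, Q, hQ, hQ'⟩ := exists_clear_denominators (θ := θ) (y := y) (d := d)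
      (H := fun i => H (Sum.inl i)) (fun i => hH (Sum.inl i)) f
    rw [hev f hf, mul_zero] at hQ
    have h := hQ' x T hdx
    rw [hroot Q hQ.symm x T hx] at h
    exact (mul_eq_zero.1 h).resolve_left (pow_ne_zero _ hdx)

open Polynomial in
theorem exists_generic_parametrization {σ τ : Type*} [Fintype τ]
    (P : Ideal (MvPolynomial (σ ⊕ τ) ℂ)) [P.IsPrime]
    (hinj : ∀ f : MvPolynomial σ ℂ, MvPolynomial.rename Sum.inl f ∈ P → f = 0)
    (hy : ∀ i, MvPolynomial.X (Sum.inr i) ∉ P)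
    (halg : ∀ i, ∃ p : (MvPolynomial σ ℂ)[X], p ≠ 0 ∧
      eval₂ (MvPolynomial.rename Sum.inl : MvPolynomial σ ℂ →ₐ[ℂ] _).toRingHom
        (MvPolynomial.X (Sum.inr i)) p ∈ P) :
    ∃ (m : (MvPolynomial σ ℂ)[X]) (d : MvPolynomial σ ℂ) (H H' : τ → (MvPolynomial σ ℂ)[X]),
      m.Monic ∧ m.natDegree ≠ 0 ∧ d ≠ 0 ∧ ∀ x T, evalPair x T m = 0 → MvPolynomial.eval x d ≠ 0 →
        evalPair x T (derivative m) ≠ 0 ∧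
        (∀ i, evalPair x T (H i) * evalPair x T (H' i) = MvPolynomial.eval x d ^ 2) ∧
        ∀ f ∈ P, MvPolynomial.eval
          (Sum.elim x fun i => evalPair x T (H i) / MvPolynomial.eval x d) f = 0 :=
  exists_generic_parametrization_of_field (K := FractionRing (MvPolynomial (σ ⊕ τ) ℂ ⧸ P)) P
    ((algebraMap _ _).comp (Ideal.Quotient.mk P)) (fun f => by
      rw [RingHom.comp_apply, map_eq_zero_iff _ (IsFractionRing.injective _ _),
        Ideal.Quotient.eq_zero_iff_mem]) hinj hy halg

/-! ### Analysis: holomorphic roots and logarithms on convex sets. -/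

open Topology in
/-- A continuous solution of a regular implicit equation is as smooth as the equation. -/
theorem contDiffAt_of_implicit {E : Type*} [NormedAddCommGroup E] [NormedSpace ℂ E] [CompleteSpace E]
    {f : E × ℂ → ℂ} {θ : E → ℂ} {x : E} {c : ℂ} (hf : ContDiffAt ℂ 1 f (x, θ x))
    (hc : HasDerivAt (fun T => f (x, T)) c (θ x)) (hc0 : c ≠ 0) (hθ : ContinuousAt θ x)
    (h0 : ∀ᶠ z in 𝓝 x, f (z, θ z) = f (x, θ x)) : ContDiffAt ℂ 1 θ x := by
  have hinv : (fderiv ℂ f (x, θ x) ∘L .inr ℂ E ℂ).IsInvertible := by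
    have h1 : HasFDerivAt (fun T => f (x, T)) (fderiv ℂ f (x, θ x) ∘L .inr ℂ E ℂ) (θ x) :=
      HasFDerivAt.comp (θ x) (hf.differentiableAt one_ne_zero).hasFDerivAt
        (hasFDerivAt_prodMk_right x (θ x))
    rw [h1.unique hc.hasFDerivAt]
    exact ⟨ContinuousLinearEquiv.unitsEquivAut ℂ (Units.mk0 c hc0), by ext; simp⟩
  have hev := hf.eventually_apply_eq_iff_implicitFunction one_ne_zero hinv
  have hcont : Filter.Tendsto (fun z => (z, θ z)) (𝓝 x) (𝓝 (x, θ x)) :=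
    (continuousAt_id.prodMk hθ)
  refine (hf.contDiffAt_implicitFunction one_ne_zero hinv).congr_of_eventuallyEq ?_
  filter_upwards [hcont.eventually hev, h0] with z hz hz0
  exact (hz.1 hz0).symm

open Topology in
/-- Near a regular point, the projection of a hypersurface to the base is a local homeomorphism. -/
theorem isLocalHomeomorphOn_fst_of_regular {E : Type*} [NormedAddCommGroup E] [NormedSpace ℂ E]
    [CompleteSpace E] {f : E × ℂ → ℂ} (hf : ContDiff ℂ 1 f) (s : Set {z : E × ℂ // f z = 0})
    (hs : ∀ z ∈ s, ∃ c ≠ 0, HasDerivAt (fun T => f (z.1.1, T)) c z.1.2) :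
    IsLocalHomeomorphOn (fun z : {z : E × ℂ // f z = 0} => z.1.1) s := by
  classical
  intro z hz
  obtain ⟨c, hc0, hc⟩ := hs z hz
  obtain ⟨⟨x, T⟩, hz0⟩ := z
  have hinv : (fderiv ℂ f (x, T) ∘L .inr ℂ E ℂ).IsInvertible := by
    have h1 : HasFDerivAt (fun T => f (x, T)) (fderiv ℂ f (x, T) ∘L .inr ℂ E ℂ) T :=
      HasFDerivAt.comp T (hf.contDiffAt.differentiableAt one_ne_zero).hasFDerivAt
        (hasFDerivAt_prodMk_right x T)
    rw [h1.unique hc.hasFDerivAt]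
    exact ⟨ContinuousLinearEquiv.unitsEquivAut ℂ (Units.mk0 c hc0), by ext; simp⟩
  let φ := (hf.contDiffAt.hasStrictFDerivAt one_ne_zero
    (x := (x, T))).implicitFunctionDataOfProdDomain hinv
  -- `Φ` is the local chart `w ↦ (f w, w.1)`; its slice `f = 0` provides the local inverse of the
  -- projection.
  let Φ := φ.toOpenPartialHomeomorph
  have hΦ : ∀ w, Φ w = (f w, w.1) := fun w => by
    simp only [Φ, φ.toOpenPartialHomeomorph_coe]
    rfl
  have hmem : (x, T) ∈ Φ.source := φ.pt_mem_toOpenPartialHomeomorph_source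
  have hsymm : ∀ y, (0, y) ∈ Φ.target → f (Φ.symm (0, y)) = 0 ∧ (Φ.symm (0, y)).1 = y := by
    intro y hy
    have h := Φ.right_inv hy
    rw [hΦ, Prod.mk.injEq] at h
    exact h
  let ψ : E → {z : E × ℂ // f z = 0} := fun y =>
    if h : f (Φ.symm (0, y)) = 0 then ⟨Φ.symm (0, y), h⟩ else ⟨(x, T), hz0⟩
  have hψ : ∀ y, (0, y) ∈ Φ.target → (ψ y).1 = Φ.symm (0, y) := fun y hy => by
    simp only [ψ, dif_pos (hsymm y hy).1]
  refine ⟨{ toFun := fun z => z.1.1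
            invFun := ψ
            source := {w | w.1 ∈ Φ.source}
            target := {y | (0, y) ∈ Φ.target}
            map_source' := fun w hw => ?_
            map_target' := fun y hy => ?_
            left_inv' := fun w hw => ?_
            right_inv' := fun y hy => ?_
            open_source := Φ.open_source.preimage continuous_subtype_val
            open_target := Φ.open_target.preimage (by fun_prop)
            continuousOn_toFun := by fun_prop
            continuousOn_invFun := ?_ }, hmem, rfl⟩
  · have h := Φ.map_source hw
    rwa [hΦ, w.2] at h
  · change (ψ y).1 ∈ Φ.source
    rw [hψ y hy]
    exact Φ.map_target hy
  · have h := Φ.map_source hw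
    rw [hΦ, w.2] at h
    apply Subtype.ext
    rw [hψ _ h]
    have h' := Φ.left_inv hw
    rwa [hΦ, w.2] at h'
  · rw [hψ y hy, (hsymm y hy).2]
  · refine (Topology.IsInducing.continuousOn_iff (g := Subtype.val) ⟨rfl⟩).2 ?_
    refine ContinuousOn.congr (f := fun y => Φ.symm (0, y)) ?_ hψ
    exact Φ.continuousOn_symm.comp (by fun_prop) fun y hy => hy

theorem contDiff_eval_mvPolynomial {σ : Type*} [Fintype σ] (p : MvPolynomial σ ℂ) :
    ContDiff ℂ 1 fun x => MvPolynomial.eval x p :=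
  contDiff_iff_contDiffAt.2 fun x =>
    ((AnalyticOnNhd.eval_mvPolynomial p) x trivial).contDiffAt.of_le le_top

theorem evalPair_eq_sum {σ : Type*} (m : Polynomial (MvPolynomial σ ℂ)) (x : σ → ℂ) (T : ℂ) :
    evalPair x T m = ∑ k ∈ Finset.range (m.natDegree + 1), MvPolynomial.eval x (m.coeff k) * T ^ k := by
  rw [Polynomial.coe_eval₂RingHom, Polynomial.eval₂_eq_sum_range]

theorem contDiff_evalPair {σ : Type*} [Fintype σ] (m : Polynomial (MvPolynomial σ ℂ)) :
    ContDiff ℂ 1 fun z : (σ → ℂ) × ℂ => evalPair z.1 z.2 m := by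
  simp only [evalPair_eq_sum]
  exact ContDiff.sum fun k _ =>
    ((contDiff_eval_mvPolynomial _).comp contDiff_fst).mul (contDiff_snd.pow k)

theorem hasDerivAt_evalPair {σ : Type*} (m : Polynomial (MvPolynomial σ ℂ)) (x : σ → ℂ) (T : ℂ) :
    HasDerivAt (fun T => evalPair x T m) (evalPair x T (Polynomial.derivative m)) T := by
  have h := (m.map (MvPolynomial.eval x)).hasDerivAt T
  rw [Polynomial.derivative_map] at h
  simpa only [Polynomial.coe_eval₂RingHom, ← Polynomial.eval_map] using h

theorem norm_le_of_evalPair_eq_zero {σ : Type*} {m : Polynomial (MvPolynomial σ ℂ)} (hm : m.Monic)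
    {x : σ → ℂ} {T : ℂ} (h : evalPair x T m = 0) :
    ‖T‖ ≤ 1 + ∑ k ∈ Finset.range m.natDegree, ‖MvPolynomial.eval x (m.coeff k)‖ := by
  set S := ∑ k ∈ Finset.range m.natDegree, ‖MvPolynomial.eval x (m.coeff k)‖ with hS
  have hS0 : 0 ≤ S := Finset.sum_nonneg fun _ _ => norm_nonneg _
  by_contra! hT
  have hT1 : 1 ≤ ‖T‖ := by linarith
  rw [evalPair_eq_sum, Finset.sum_range_succ, hm.coeff_natDegree, map_one, one_mul] at h
  rcases Nat.eq_zero_or_pos m.natDegree with h0 | hpos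
  · simp [h0] at h
  obtain ⟨N, hN⟩ := Nat.exists_eq_succ_of_ne_zero hpos.ne'
  have h1 : ‖T‖ ^ m.natDegree ≤ S * ‖T‖ ^ N := by
    rw [← norm_pow, eq_neg_of_add_eq_zero_right h, norm_neg, hS, Finset.sum_mul]
    refine (norm_sum_le _ _).trans (Finset.sum_le_sum fun k hk => ?_)
    rw [norm_mul, norm_pow]
    have : k ≤ N := by rw [Finset.mem_range] at hk; omega
    gcongr
  rw [hN, pow_succ'] at h1
  have := le_of_mul_le_mul_right h1 (by positivity)
  linarith

-- Roots of a monic polynomial stay bounded while its coefficients do, so the projection is proper.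
open Topology in
theorem isClosedMap_fst_zeros {σ : Type*} [Fintype σ] {m : Polynomial (MvPolynomial σ ℂ)}
    (hm : m.Monic) :
    IsClosedMap fun z : {z : (σ → ℂ) × ℂ // evalPair z.1 z.2 m = 0} => z.1.1 := by
  have hc : Continuous fun x : σ → ℂ =>
      1 + ∑ k ∈ Finset.range m.natDegree, ‖MvPolynomial.eval x (m.coeff k)‖ := by
    have := fun k => (contDiff_eval_mvPolynomial (m.coeff k)).continuous
    fun_prop
  refine IsProperMap.isClosedMap (isProperMap_iff_isCompact_preimage.2 ⟨by fun_prop, fun K hK => ?_⟩)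
  obtain ⟨C, hC⟩ := (hK.image hc).bddAbove
  rw [Topology.IsEmbedding.subtypeVal.isCompact_iff]
  have hcl : IsClosed {z : (σ → ℂ) × ℂ | evalPair z.1 z.2 m = 0} :=
    isClosed_singleton.preimage (contDiff_evalPair m).continuous
  refine ((hK.prod (isCompact_closedBall (0 : ℂ) C)).inter_right hcl).of_isClosed_subset ?_ ?_
  · have : (Subtype.val '' ((fun z : {z : (σ → ℂ) × ℂ // evalPair z.1 z.2 m = 0} => z.1.1) ⁻¹' K))
        = {z | evalPair z.1 z.2 m = 0} ∩ Prod.fst ⁻¹' K := by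
      ext z
      simp [and_comm]
    rw [this]
    exact hcl.inter (hK.isClosed.preimage continuous_fst)
  · rintro _ ⟨z, hz, rfl⟩
    refine ⟨⟨hz, ?_⟩, z.2⟩
    rw [mem_closedBall_zero_iff]
    exact (norm_le_of_evalPair_eq_zero hm z.2).trans (hC ⟨_, hz, rfl⟩)

/-- A monic polynomial over `ℂ[x]` has a smooth root on every convex open set over which all of its
roots are simple. -/
theorem exists_smooth_root {σ : Type*} [Fintype σ] {m : Polynomial (MvPolynomial σ ℂ)}
    (hm : m.Monic) (hdeg : m.natDegree ≠ 0) {U : Set (σ → ℂ)} (hU : IsOpen U) (hUc : Convex ℝ U)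
    (hUn : U.Nonempty)
    (hreg : ∀ x ∈ U, ∀ T, evalPair x T m = 0 → evalPair x T (Polynomial.derivative m) ≠ 0) :
    ∃ θ : (σ → ℂ) → ℂ, (∀ x ∈ U, evalPair x (θ x) m = 0) ∧ ∀ x ∈ U, ContDiffAt ℂ 1 θ x := by
  classical
  let p := fun z : {z : (σ → ℂ) × ℂ // evalPair z.1 z.2 m = 0} => z.1.1
  -- A closed local homeomorphism with finite fibres is a covering.
  have hcov : IsCoveringMapOn p U := by
    refine (isClosedMap_fst_zeros hm).isCoveringMapOn_of_isLocalHomeomorphOn (fun x _ => ?_)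
      (isLocalHomeomorphOn_fst_of_regular (contDiff_evalPair m) _ fun z hz =>
        ⟨_, hreg _ hz _ z.2, hasDerivAt_evalPair m _ _⟩)
    have hne : m.map (MvPolynomial.eval x) ≠ 0 := (hm.map _).ne_zero
    refine Set.Finite.of_finite_image (f := fun z => z.1.2)
      ((m.map (MvPolynomial.eval x)).roots.toFinset.finite_toSet.subset ?_) ?_
    · rintro _ ⟨z, hz, rfl⟩
      have hz' : z.1.1 = x := hz
      have h := z.2
      rw [hz', Polynomial.coe_eval₂RingHom, ← Polynomial.eval_map] at h
      simpa [Polynomial.mem_roots hne] using h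
    · intro z hz w hw h
      exact Subtype.ext (Prod.ext (Eq.trans hz (Eq.symm hw)) h)
  have : ContractibleSpace U := hUc.contractibleSpace hUn
  have : LocallyPathConnectedSpace U := hU.locallyPathConnectedSpace
  obtain ⟨x₀, hx₀⟩ := hUn
  obtain ⟨T₀, hT₀⟩ : ∃ T, evalPair x₀ T m = 0 := by
    obtain ⟨T, hT⟩ := IsAlgClosed.exists_root (m.map (MvPolynomial.eval x₀)) (by
      rw [hm.degree_map, Polynomial.degree_eq_natDegree hm.ne_zero]
      exact_mod_cast hdeg)
    exact ⟨T, by rwa [Polynomial.coe_eval₂RingHom, ← Polynomial.eval_map]⟩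
  -- The inclusion of the contractible set `U` lifts through the covering; the lift is a continuous
  -- choice of root, which the implicit equation then makes smooth.
  obtain ⟨F, ⟨-, hF⟩, -⟩ := hcov.existsUnique_continuousMap_lifts
    (⟨Subtype.val, continuous_subtype_val⟩ : C(U, σ → ℂ)) (a₀ := ⟨x₀, hx₀⟩)
    (e₀ := ⟨(x₀, T₀), hT₀⟩) rfl fun a => a.2
  have hF' : ∀ a : U, (F a).1.1 = a.1 := fun a => congrFun hF a
  let θ : (σ → ℂ) → ℂ := fun x => if h : x ∈ U then (F ⟨x, h⟩).1.2 else 0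
  have hθ : ∀ a : U, θ a = (F a).1.2 := fun a => by simp [θ]
  have hroot : ∀ x ∈ U, evalPair x (θ x) m = 0 := fun x hx => by
    have h := (F ⟨x, hx⟩).2
    rwa [hF', ← hθ] at h
  have hcont : ContinuousOn θ U := by
    rw [continuousOn_iff_continuous_domRestrict]
    have : U.domRestrict θ = fun a => (F a).1.2 := funext hθ
    rw [this]
    fun_prop
  refine ⟨θ, hroot, fun x hx => contDiffAt_of_implicit (contDiff_evalPair m).contDiffAt
    (hasDerivAt_evalPair m x (θ x)) (hreg x hx _ (hroot x hx))
    (hcont.continuousAt (hU.mem_nhds hx)) ?_⟩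
  filter_upwards [hU.mem_nhds hx] with z hz
  exact (hroot z hz).trans (hroot x hx).symm

theorem exists_smooth_log {E : Type*} [NormedAddCommGroup E] [NormedSpace ℂ E] [CompleteSpace E]
    {U : Set E} (hU : IsOpen U) (hUc : Convex ℝ U) (hUn : U.Nonempty) {g : E → ℂ}
    (hg : ∀ x ∈ U, ContDiffAt ℂ 1 g x) (hg0 : ∀ x ∈ U, g x ≠ 0) :
    ∃ l : E → ℂ, (∀ x ∈ U, Complex.exp (l x) = g x) ∧ ∀ x ∈ U, ContDiffAt ℂ 1 l x := by
  have : ContractibleSpace U := hUc.contractibleSpace hUn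
  have hsc : IsSimplyConnected U := SimplyConnectedSpace.ofContractible U
  obtain ⟨l, hl, hexp⟩ := Complex.exists_continuousOn_eqOn_exp_comp hsc hU
    (fun x hx => (hg x hx).continuousAt.continuousWithinAt)
    (by rintro ⟨x, hx, h⟩; exact hg0 x hx h)
  refine ⟨l, hexp, fun x hx => contDiffAt_of_implicit
    (f := fun z => Complex.exp z.2 - g z.1) (c := Complex.exp (l x)) ?_ ?_ (Complex.exp_ne_zero _)
    (hl.continuousAt (hU.mem_nhds hx)) ?_⟩
  · exact (contDiff_snd.cexp.contDiffAt).sub ((hg x hx).comp (x, l x) contDiffAt_fst)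
  · exact (Complex.hasDerivAt_exp (l x)).sub_const (g x)
  · filter_upwards [hU.mem_nhds hx] with z hz
    have h1 := hexp hz
    have h2 := hexp hx
    simp only [Function.comp_apply] at h1 h2
    rw [h1, h2, sub_self, sub_self]

/-! ### Polynomial growth of algebraic functions. -/

/-- A real function bounded above by a constant times a power of the weight `w`. -/
def PolyBounded {α : Type*} (w : α → ℝ) (g : α → ℝ) : Prop :=
  ∃ (C : ℝ) (N : ℕ), 0 ≤ C ∧ ∀ a, g a ≤ C * w a ^ N

namespace PolyBounded

variable {α ι : Type*} {w g h : α → ℝ}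

theorem mono (hg : PolyBounded w g) (hle : ∀ a, h a ≤ g a) : PolyBounded w h := by
  obtain ⟨C, N, hC, hb⟩ := hg
  exact ⟨C, N, hC, fun a => (hle a).trans (hb a)⟩

theorem const (c : ℝ) : PolyBounded w fun _ => c :=
  ⟨|c|, 0, abs_nonneg c, fun _ => by simpa using le_abs_self c⟩

theorem add (hw : ∀ a, 1 ≤ w a) (hg : PolyBounded w g) (hh : PolyBounded w h) :
    PolyBounded w fun a => g a + h a := by
  obtain ⟨C, N, hC, hb⟩ := hg
  obtain ⟨D, M, hD, hb'⟩ := hh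
  refine ⟨C + D, N + M, add_nonneg hC hD, fun a => ?_⟩
  have h1 : w a ^ N ≤ w a ^ (N + M) := pow_le_pow_right₀ (hw a) (Nat.le_add_right _ _)
  have h2 : w a ^ M ≤ w a ^ (N + M) := pow_le_pow_right₀ (hw a) (Nat.le_add_left _ _)
  calc g a + h a ≤ C * w a ^ N + D * w a ^ M := add_le_add (hb a) (hb' a)
    _ ≤ C * w a ^ (N + M) + D * w a ^ (N + M) := by gcongr
    _ = (C + D) * w a ^ (N + M) := by ring

theorem mul (hw : ∀ a, 1 ≤ w a) (hh0 : ∀ a, 0 ≤ h a) (hg : PolyBounded w g)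
    (hh : PolyBounded w h) : PolyBounded w fun a => g a * h a := by
  obtain ⟨C, N, hC, hb⟩ := hg
  obtain ⟨D, M, hD, hb'⟩ := hh
  refine ⟨C * D, N + M, mul_nonneg hC hD, fun a => ?_⟩
  have hwa := zero_le_one.trans (hw a)
  calc g a * h a ≤ (C * w a ^ N) * (D * w a ^ M) :=
        mul_le_mul (hb a) (hb' a) (hh0 a) (by positivity)
    _ = C * D * w a ^ (N + M) := by ring

theorem pow (hw : ∀ a, 1 ≤ w a) (hg0 : ∀ a, 0 ≤ g a) (hg : PolyBounded w g) (k : ℕ) :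
    PolyBounded w fun a => g a ^ k := by
  induction k with
  | zero => simpa using const 1
  | succ k ih => simpa only [pow_succ] using ih.mul hw hg0 hg

theorem sum (hw : ∀ a, 1 ≤ w a) (s : Finset ι) {f : ι → α → ℝ}
    (hf : ∀ i ∈ s, PolyBounded w (f i)) : PolyBounded w fun a => ∑ i ∈ s, f i a := by
  classical
  induction s using Finset.induction_on with
  | empty => simpa using const 0
  | insert i s hi ih =>
    simp only [Finset.sum_insert hi]
    exact (hf i (Finset.mem_insert_self i s)).add hw
      (ih fun j hj => hf j (Finset.mem_insert_of_mem hj))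

theorem eval {σ : Type*} [Fintype σ] {x : α → σ → ℂ} (p : MvPolynomial σ ℂ) :
    PolyBounded (fun a => 1 + ‖x a‖) fun a => ‖MvPolynomial.eval (x a) p‖ := by
  have hw : ∀ a, 1 ≤ 1 + ‖x a‖ := fun a => by linarith [norm_nonneg (x a)]
  induction p using MvPolynomial.induction_on with
  | C c => simpa using const ‖c‖
  | add p q hp hq => exact (hp.add hw hq).mono fun a => by rw [map_add]; exact norm_add_le _ _
  | mul_X p i hp =>
    refine PolyBounded.mono (hp.mul hw (h := fun a => 1 + ‖x a‖) (fun a => by positivity)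
      ⟨1, 1, zero_le_one, fun a => by simp⟩) fun a => ?_
    rw [map_mul, MvPolynomial.eval_X, norm_mul]
    have := norm_le_pi_norm (x a) i
    gcongr
    linarith

/-- Monicity is essential: it bounds the root `T` polynomially in `x`, with no denominator. -/
theorem evalPair {σ : Type*} [Fintype σ] {x : α → σ → ℂ} {T : α → ℂ}
    {m : Polynomial (MvPolynomial σ ℂ)} (hm : m.Monic) (hT : ∀ a, evalPair (x a) (T a) m = 0)
    (p : Polynomial (MvPolynomial σ ℂ)) :
    PolyBounded (fun a => 1 + ‖x a‖) fun a => ‖_root_.evalPair (x a) (T a) p‖ := by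
  have hw : ∀ a, 1 ≤ 1 + ‖x a‖ := fun a => by linarith [norm_nonneg (x a)]
  have hTb : PolyBounded (fun a => 1 + ‖x a‖) fun a => ‖T a‖ :=
    ((const 1).add hw (sum hw _ fun k _ => eval (m.coeff k))).mono fun a =>
      norm_le_of_evalPair_eq_zero hm (hT a)
  refine (sum hw (Finset.range (p.natDegree + 1)) fun k _ => (eval (p.coeff k)).mul hw
    (fun a => by positivity) (hTb.pow hw (fun a => norm_nonneg _) k)).mono fun a => ?_
  rw [evalPair_eq_sum]
  refine (norm_sum_le _ _).trans_eq (Finset.sum_congr rfl fun k _ => ?_)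
  rw [norm_mul, norm_pow]

end PolyBounded

/-! ### Lower bounds along a lattice direction. -/

theorem homogeneousComponent_totalDegree_ne_zero {σ R : Type*} [CommSemiring R]
    {p : MvPolynomial σ R} (hp : p ≠ 0) :
    MvPolynomial.homogeneousComponent p.totalDegree p ≠ 0 := by
  obtain ⟨s, hs, hdeg⟩ := Finset.exists_mem_eq_sup p.support
    (MvPolynomial.support_nonempty.2 hp) fun s => s.sum fun _ e => e
  intro h
  have hc := congrArg (MvPolynomial.coeff s) h
  rw [MvPolynomial.coeff_homogeneousComponent, if_pos, MvPolynomial.coeff_zero] at hc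
  · exact MvPolynomial.mem_support_iff.1 hs hc
  · exact hdeg.symm

theorem eval_smul_of_isHomogeneous {σ R : Type*} [Fintype σ] [CommSemiring R]
    {p : MvPolynomial σ R} {n : ℕ} (hp : p.IsHomogeneous n) (t : R) (x : σ → R) :
    MvPolynomial.eval (t • x) p = t ^ n * MvPolynomial.eval x p := by
  rw [MvPolynomial.eval_eq', MvPolynomial.eval_eq', Finset.mul_sum]
  refine Finset.sum_congr rfl fun d hd => ?_
  have hdeg : ∑ i, d i = n := by
    have h := hp (MvPolynomial.mem_support_iff.1 hd)
    rw [← Finsupp.degree_eq_sum, ← h, Finsupp.degree_eq_weight_one]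
    rfl
  simp only [Pi.smul_apply, smul_eq_mul, mul_pow, Finset.prod_mul_distrib, Finset.prod_pow_eq_pow_sum,
    hdeg]
  ring

/-- A nonzero polynomial is bounded away from zero in a conic neighbourhood of some direction in
the lattice `(2πiℤ)^σ`, far from the origin. -/
theorem exists_lattice_direction {σ : Type*} [Fintype σ] {p : MvPolynomial σ ℂ} (hp : p ≠ 0) :
    ∃ (k : σ → ℤ) (c δ t₀ : ℝ), 0 < c ∧ 0 < δ ∧ ∀ t, t₀ ≤ t → ∀ x : σ → ℂ,
      ‖x - t • (fun i => (k i : ℂ) * (2 * Real.pi * Complex.I))‖ < c * t →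
        δ ≤ ‖MvPolynomial.eval x p‖ := by
  set N := p.totalDegree with hN
  obtain ⟨v, hv, hvN⟩ : ∃ v ∈ Set.univ.pi fun _ : σ =>
      Set.range fun k : ℤ => (k : ℂ) * (2 * Real.pi * Complex.I),
      MvPolynomial.eval v (MvPolynomial.homogeneousComponent N p) ≠ 0 := by
    -- A product of infinite subsets of `ℂ` is Zariski dense, so the leading form cannot vanish on
    -- the whole lattice.
    by_contra! h
    refine homogeneousComponent_totalDegree_ne_zero hp
      (MvPolynomial.funext_set _ (fun _ => ?_) fun x hx => (h x hx).trans (map_zero _).symm)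
    refine Set.infinite_range_of_injective fun a b hab => ?_
    exact_mod_cast mul_right_cancel₀ Complex.two_pi_I_ne_zero hab
  choose k hk using fun i => hv i trivial
  have hkv : (fun i => (k i : ℂ) * (2 * Real.pi * Complex.I)) = v := funext hk
  -- The homogenization of `p`: `p(x) = t^N g(1/t, x/t)`. Continuity at `(0, v)`, where `g` is the
  -- leading form, gives the conic neighbourhood.
  let g : ℝ × (σ → ℂ) → ℂ := fun z => ∑ j ∈ Finset.range (N + 1),
    (z.1 : ℂ) ^ (N - j) * MvPolynomial.eval z.2 (MvPolynomial.homogeneousComponent j p)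
  have hg : Continuous g := by
    have := fun j => (contDiff_eval_mvPolynomial
      (MvPolynomial.homogeneousComponent j p)).continuous
    fun_prop
  have hg0 : g (0, v) ≠ 0 := by
    simp only [g]
    rw [Finset.sum_range_succ, Finset.sum_eq_zero fun j hj => ?_]
    · simpa using hvN
    · rw [Complex.ofReal_zero, zero_pow (by rw [Finset.mem_range] at hj; omega), zero_mul]
  have hev : ∀ᶠ z in nhds ((0 : ℝ), v), ‖g (0, v)‖ / 2 < ‖g z‖ :=
    hg.norm.continuousAt.eventually (lt_mem_nhds (half_lt_self (norm_pos_iff.2 hg0)))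
  obtain ⟨ε, hε, hball⟩ := Metric.eventually_nhds_iff.1 hev
  refine ⟨k, ε, ‖g (0, v)‖ / 2, 1 + 1 / ε, hε, by positivity, fun t ht x hx => ?_⟩
  rw [hkv] at hx
  have ht1 : 1 ≤ t := le_trans (by linarith [one_div_pos.2 hε]) ht
  have ht0 : 0 < t := by linarith
  have hscale : MvPolynomial.eval x p = (t : ℂ) ^ N * g (t⁻¹, t⁻¹ • x) := by
    conv_lhs => rw [← MvPolynomial.sum_homogeneousComponent p]
    rw [map_sum, Finset.mul_sum]
    refine Finset.sum_congr rfl fun j hj => ?_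
    have hj' : j ≤ N := by rw [Finset.mem_range] at hj; omega
    have hx' : x = (t : ℂ) • (t⁻¹ • x) := by
      ext i
      simp [mul_inv_cancel_left₀ (Complex.ofReal_ne_zero.2 ht0.ne')]
    conv_lhs => rw [hx']
    rw [eval_smul_of_isHomogeneous (MvPolynomial.homogeneousComponent_isHomogeneous j p)]
    obtain ⟨l, hl⟩ : ∃ l, N = j + l := ⟨N - j, by omega⟩
    have := Complex.ofReal_ne_zero.2 ht0.ne'
    rw [hl, Nat.add_sub_cancel_left, Complex.ofReal_inv, pow_add, mul_assoc, inv_pow,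
      mul_inv_cancel_left₀ (pow_ne_zero l this)]
  have hb := hball (y := (t⁻¹, t⁻¹ • x)) (by
    rw [Prod.dist_eq, max_lt_iff, Real.dist_eq, sub_zero, abs_of_pos (inv_pos.2 ht0), dist_eq_norm]
    constructor
    · rw [inv_lt_comm₀ ht0 hε]
      rw [one_div] at ht
      linarith
    · have : t⁻¹ • x - v = t⁻¹ • (x - t • v) := by
        rw [smul_sub, smul_smul, inv_mul_cancel₀ ht0.ne', one_smul]
      rw [this, norm_smul, norm_inv, Real.norm_eq_abs, abs_of_pos ht0, inv_mul_lt_iff₀ ht0, mul_comm]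
      exact hx)
  rw [hscale, norm_mul, norm_pow, Complex.norm_real, Real.norm_eq_abs, abs_of_pos ht0]
  have : 1 ≤ t ^ N := one_le_pow₀ ht1
  nlinarith [norm_nonneg (g (t⁻¹, t⁻¹ • x))]

/-! ### Solving the exponential system by a contraction. -/

/-- A holomorphic function with bounded real part on a ball of radius `r` is Lipschitz on the
concentric ball of radius `r / 4`, with constant inversely proportional to `r`. -/
theorem norm_sub_le_of_abs_re_le {E : Type*} [NormedAddCommGroup E] [NormedSpace ℂ E] {l : E → ℂ}
    {a : E} {r M : ℝ} (hr : 0 < r) (hM : 0 < M)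
    (hl : ∀ x ∈ Metric.ball a r, DifferentiableAt ℂ l x)
    (hre : ∀ x ∈ Metric.ball a r, |(l x).re| ≤ M) {x y : E}
    (hx : ‖x - a‖ ≤ r / 4) (hy : ‖y - a‖ ≤ r / 4) :
    ‖l y - l x‖ ≤ 16 * M / r * ‖y - x‖ := by
  rcases eq_or_ne y x with rfl | hne
  · simp
  set h := ‖y - x‖ with hh
  have hh0 : 0 < h := norm_pos_iff.2 (sub_ne_zero.2 hne)
  have hhr : h ≤ r / 2 := by
    have := norm_sub_le (y - a) (x - a)
    rw [sub_sub_sub_cancel_right] at this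
    linarith
  have hmaps : ∀ s ∈ Metric.ball (0 : ℂ) (3 * r / 4 / h), x + s • (y - x) ∈ Metric.ball a r := by
    intro s hs
    rw [mem_ball_zero_iff, lt_div_iff₀ hh0] at hs
    rw [mem_ball_iff_norm, add_sub_right_comm]
    refine (norm_add_le _ _).trans_lt ?_
    rw [norm_smul]
    linarith
  have hR : 1 < 3 * r / 4 / h := by rw [lt_div_iff₀ hh0]; linarith
  have hxa : x ∈ Metric.ball a r := by rw [mem_ball_iff_norm]; linarith
  -- Borel–Carathéodory on the complex line through `x` and `y`, evaluated at `s = 1`. The radius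
  -- `3r/(4h)` keeps the line within the ball, as `x` is within `r/4` of `a`; subtracting `l x`
  -- doubles the bound on the real part.
  have hbc := Complex.borelCaratheodory_zero (f := fun s => l (x + s • (y - x)) - l x)
    (M := 2 * M) (R := 3 * r / 4 / h) (z := 1) (by positivity)
    (fun s hs => by
      have := hl _ (hmaps s hs)
      exact (DifferentiableAt.sub_const (DifferentiableAt.comp s this (by fun_prop)) _).differentiableWithinAt)
    (fun s hs => by
      have h1 := (abs_le.1 (hre _ (hmaps s hs))).2
      have h2 := (abs_le.1 (hre _ hxa)).1
      simp only [Set.mem_ofPred_eq, Complex.sub_re]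
      linarith)
    (by positivity) (by simpa using hR) (by simp)
  simp only [one_smul, add_sub_cancel, norm_one, mul_one] at hbc
  refine hbc.trans ?_
  have hd : r / 4 / h ≤ 3 * r / 4 / h - 1 := by
    rw [le_sub_iff_add_le, div_add_one hh0.ne']
    gcongr
    linarith
  calc 2 * (2 * M) / (3 * r / 4 / h - 1) ≤ 2 * (2 * M) / (r / 4 / h) := by gcongr
    _ = 16 * M / r * h := by field_simp; ring

/-- The system `exp xᵢ = exp aᵢ * exp (lᵢ x)` has a solution in a large ball around `a` when the
real parts of the holomorphic functions `lᵢ` are small compared with the radius. -/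
theorem exists_exp_eq_exp_mul_exp {σ : Type*} [Fintype σ] {l : σ → (σ → ℂ) → ℂ} {a : σ → ℂ}
    {r M : ℝ} (hM : 0 < M) (hr : 40 * (M + 4) ≤ r)
    (hl : ∀ i, ∀ x ∈ Metric.ball a r, DifferentiableAt ℂ (l i) x)
    (hre : ∀ i, ∀ x ∈ Metric.ball a r, |(l i x).re| ≤ M) :
    ∃ x ∈ Metric.ball a r, ∀ i, Complex.exp (x i) = Complex.exp (a i) * Complex.exp (l i x) := by
  have hr0 : 0 < r := by linarith
  -- The imaginary part of `l i a` is uncontrolled; reducing it modulo `2πi` leaves the exponential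
  -- unchanged and bounds `b` by `M + π`.
  let b : σ → ℂ := fun i => Complex.log (Complex.exp (l i a))
  have hb : ‖b‖ ≤ M + 4 := by
    rw [pi_norm_le_iff_of_nonneg (by linarith)]
    intro i
    have h1 : (b i).re = (l i a).re := by
      simp only [b]
      rw [Complex.log_re, Complex.norm_exp, Real.log_exp]
    have h2 : |(b i).im| ≤ Real.pi := by
      simp only [b, Complex.log_im]
      exact Complex.abs_arg_le_pi _
    have h3 := hre i a (Metric.mem_ball_self hr0)
    rw [← h1] at h3
    linarith [Complex.norm_le_abs_re_add_abs_im (b i), Real.pi_lt_four]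
  -- A fixed point solves the system because `b i` and `l i a` have the same exponential. The
  -- contraction needs `32 M ≤ r`, and stability of the ball of radius `r/4` needs `8 (M + 4) ≤ r`;
  -- the constant `40` covers both.
  let Φ : (σ → ℂ) → (σ → ℂ) := fun x i => a i + (l i x - l i a + b i)
  have hΦ : ∀ x ∈ Metric.closedBall a (r / 4), ∀ y ∈ Metric.closedBall a (r / 4),
      dist (Φ x) (Φ y) ≤ ((1 / 2 : NNReal) : ℝ) * dist x y := by
    intro x hx y hy
    rw [mem_closedBall_iff_norm] at hx hy
    rw [dist_pi_le_iff (by positivity)]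
    intro i
    have h1 := norm_sub_le_of_abs_re_le hr0 hM (hl i) (hre i) hy hx
    have h2 : 16 * M / r ≤ 1 / 2 := by rw [div_le_iff₀ hr0]; linarith
    rw [dist_eq_norm, dist_eq_norm]
    have h3 : Φ x i - Φ y i = l i x - l i y := by simp only [Φ]; ring
    rw [h3]
    refine h1.trans ?_
    push_cast
    gcongr
  have ha : a ∈ Metric.closedBall a (r / 4) := Metric.mem_closedBall_self (by linarith)
  have hΦa : Φ a = a + b := by ext i; simp [Φ]
  have hmaps : Set.MapsTo Φ (Metric.closedBall a (r / 4)) (Metric.closedBall a (r / 4)) := by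
    intro x hx
    have h1 := hΦ x hx a ha
    have h2 := dist_triangle (Φ x) (Φ a) a
    rw [Metric.mem_closedBall] at hx ⊢
    have h3 : dist (Φ a) a ≤ M + 4 := by rw [hΦa, dist_self_add_left]; exact hb
    push_cast at h1
    linarith
  obtain ⟨x, hx, hfix, -⟩ := ContractingWith.exists_fixedPoint' (K := 1 / 2)
    Metric.isClosed_closedBall.isComplete hmaps
    ⟨by rw [← NNReal.coe_lt_coe]; norm_num,
      (LipschitzOnWith.of_dist_le_mul hΦ).mapsToRestrict hmaps⟩ ha (edist_ne_top _ _)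
  refine ⟨x, Metric.closedBall_subset_ball (by linarith) hx, fun i => ?_⟩
  have h := congrFun hfix i
  simp only [Φ, b] at h
  rw [← h]
  rw [Complex.exp_add, Complex.exp_add, Complex.exp_log (Complex.exp_ne_zero _), Complex.exp_sub,
    div_mul_cancel₀ _ (Complex.exp_ne_zero _)]

/-! ### Zariski topology: from closed sets to polynomials and prime ideals. -/

theorem isClosed_zariskiTopology_iff {σ K : Type*} [Field K] {Z : Set (σ → K)} :
    @IsClosed _ (zariskiTopology σ K) Z ↔
      ∃ S : Set (MvPolynomial σ K), Z = {x | ∀ p ∈ S, MvPolynomial.eval x p = 0} := by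
  let _ := zariskiTopology σ K
  rw [← isOpen_compl_iff]
  change Zᶜᶜ ∈ _ ↔ _
  rw [compl_compl]
  rfl

theorem zariskiDense_iff {n : ℕ} {s : Set (Fin n → ℂ)} :
    ZariskiDense s ↔ ∀ q : MvPolynomial (Fin n) ℂ, q ≠ 0 → ∃ a ∈ s, MvPolynomial.eval a q ≠ 0 := by
  let _ := zariskiTopology (Fin n) ℂ
  constructor
  · intro hs q hq
    by_contra! h
    have hcl : IsClosed {x : Fin n → ℂ | MvPolynomial.eval x q = 0} :=
      isClosed_zariskiTopology_iff.2 ⟨{q}, by simp⟩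
    have huniv : Dense {x : Fin n → ℂ | MvPolynomial.eval x q = 0} := hs.mono h
    have huniv' := huniv.closure_eq
    rw [hcl.closure_eq] at huniv'
    exact hq (MvPolynomial.funext fun x => by
      rw [map_zero]
      exact huniv'.ge (Set.mem_univ x))
  · intro h
    refine dense_iff_inter_open.2 fun U hU hUn => ?_
    have hUc : IsClosed Uᶜ := hU.isClosed_compl
    obtain ⟨S, hS⟩ := isClosed_zariskiTopology_iff.1 hUc
    obtain ⟨x, hx⟩ := hUn
    have hx' : x ∉ Uᶜ := fun h => h hx
    rw [hS] at hx'
    simp only [Set.mem_ofPred_eq, not_forall] at hx'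
    obtain ⟨p, hp, hpx⟩ := hx'
    obtain ⟨a, ha, hpa⟩ := h p (by rintro rfl; exact hpx (map_zero _))
    refine ⟨a, ?_, ha⟩
    by_contra hU'
    have : a ∈ Uᶜ := hU'
    rw [hS] at this
    exact hpa (this p hp)

theorem isClosed_zariskiTopologyG_iff {n : ℕ} {Z : Set (GPoints n)} :
    @IsClosed _ (zariskiTopologyG n) Z ↔ ∃ S : Set (MvPolynomial (Fin n ⊕ Fin n) ℂ),
      Z = {g | ∀ p ∈ S, MvPolynomial.eval g.toAffine p = 0} := by
  let _ := zariskiTopology (Fin n ⊕ Fin n) ℂ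
  rw [isClosed_induced_iff]
  constructor
  · rintro ⟨t, ht, rfl⟩
    obtain ⟨S, rfl⟩ := isClosed_zariskiTopology_iff.1 ht
    exact ⟨S, rfl⟩
  · rintro ⟨S, rfl⟩
    exact ⟨_, isClosed_zariskiTopology_iff.2 ⟨S, rfl⟩, rfl⟩

/-- The polynomial `p(x, y_i)`. -/
noncomputable def systemPoly {n : ℕ} (i : Fin n) (p : Polynomial (MvPolynomial (Fin n) ℂ)) :
    MvPolynomial (Fin n ⊕ Fin n) ℂ :=
  Polynomial.eval₂ (MvPolynomial.rename Sum.inl : MvPolynomial (Fin n) ℂ →ₐ[ℂ] _).toRingHom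
    (MvPolynomial.X (Sum.inr i)) p

theorem eval_rename_inl {n : ℕ} (g : GPoints n) (f : MvPolynomial (Fin n) ℂ) :
    MvPolynomial.eval g.toAffine (MvPolynomial.rename Sum.inl f) = MvPolynomial.eval g.1 f := by
  rw [MvPolynomial.eval_rename]
  rfl

theorem eval_systemPoly {n : ℕ} (i : Fin n) (p : Polynomial (MvPolynomial (Fin n) ℂ))
    (g : GPoints n) : MvPolynomial.eval g.toAffine (systemPoly i p) = evalAt p g.1 (g.2 i) := by
  rw [systemPoly, Polynomial.hom_eval₂, evalAt, Polynomial.eval_map, MvPolynomial.eval_X]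
  congr 1
  exact RingHom.ext fun f => eval_rename_inl g f

theorem isClosed_systemZeros {n : ℕ} (p : Fin n → Polynomial (MvPolynomial (Fin n) ℂ)) :
    @IsClosed _ (zariskiTopologyG n) (systemZeros p) := by
  refine isClosed_zariskiTopologyG_iff.2 ⟨Set.range fun i => systemPoly i (p i), ?_⟩
  ext g
  simp [systemZeros, eval_systemPoly]

/-- The closure of `V` is irreducible and stays inside the closed set `S`, so maximality applies. -/
theorem IsIrreducibleComponentOf.isClosed {n : ℕ} {V S : Set (GPoints n)}
    (hV : IsIrreducibleComponentOf V S) (hS : @IsClosed _ (zariskiTopologyG n) S) :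
    @IsClosed _ (zariskiTopologyG n) V := by
  let _ := zariskiTopologyG n
  have h := hV.2 (y := closure V) ⟨closure_minimal hV.1.1 hS, hV.1.2.closure⟩ subset_closure
  rw [← Set.Subset.antisymm h subset_closure]
  exact isClosed_closure

/-- The ideal of polynomials vanishing on a subset of `G_n(ℂ)`. -/
def vanishingIdealG {n : ℕ} (V : Set (GPoints n)) : Ideal (MvPolynomial (Fin n ⊕ Fin n) ℂ) where
  carrier := {f | ∀ g ∈ V, MvPolynomial.eval g.toAffine f = 0}
  add_mem' hf hf' g hg := by rw [map_add, hf g hg, hf' g hg, add_zero]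
  zero_mem' g _ := map_zero _
  smul_mem' c f hf g hg := by rw [smul_eq_mul, map_mul, hf g hg, mul_zero]

theorem isPrime_vanishingIdealG {n : ℕ} {V : Set (GPoints n)}
    (hV : @IsIrreducible _ (zariskiTopologyG n) V) : (vanishingIdealG V).IsPrime := by
  let _ := zariskiTopologyG n
  obtain ⟨⟨v, hv⟩, hirr⟩ := hV
  refine ⟨fun h => ?_, fun {f f'} hff => ?_⟩
  · have h1 : (1 : MvPolynomial (Fin n ⊕ Fin n) ℂ) ∈ vanishingIdealG V := h ▸ trivial
    simpa using h1 v hv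
  · have hcl : ∀ f, IsClosed {g : GPoints n | MvPolynomial.eval g.toAffine f = 0} := fun f =>
      isClosed_zariskiTopologyG_iff.2 ⟨{f}, by simp⟩
    refine isPreirreducible_iff_isClosed_union_isClosed.1 hirr _ _ (hcl f) (hcl f') fun g hg => ?_
    have h := hff g hg
    rw [map_mul] at h
    exact mul_eq_zero.1 h

/-! ### Points of the exponential graph on the variety. -/

open Filter in
theorem eventually_const_add_mul_log_le (K N : ℝ) {c : ℝ} (hc : 0 < c) :
    ∀ᶠ t : ℝ in atTop, K + N * Real.log t ≤ c * t := by
  have h : (fun t : ℝ => K + N * Real.log t) =o[atTop] (id : ℝ → ℝ) :=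
    (Asymptotics.isLittleO_const_id_atTop K).add (Real.isLittleO_log_id_atTop.const_mul_left N)
  filter_upwards [h.def hc, eventually_ge_atTop 0] with t ht ht0
  rw [id, Real.norm_eq_abs, Real.norm_eq_abs, abs_of_nonneg ht0] at ht
  exact (le_abs_self _).trans ht

/-- An algebraic multifunction `y = H(x, θ) / d(x)`, `θ` a root of a monic generically separable
polynomial, that is invertible with inverse of the same form, meets the graph of the exponential
map outside any given hypersurface. -/
theorem exists_exp_eq_algebraic {n : ℕ} {m : Polynomial (MvPolynomial (Fin n) ℂ)}
    {d q : MvPolynomial (Fin n) ℂ} {H H' : Fin n → Polynomial (MvPolynomial (Fin n) ℂ)}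
    (hm : m.Monic) (hdeg : m.natDegree ≠ 0) (hd : d ≠ 0) (hq : q ≠ 0)
    (hsep : ∀ x T, evalPair x T m = 0 → MvPolynomial.eval x d ≠ 0 →
      evalPair x T (Polynomial.derivative m) ≠ 0)
    (hinv : ∀ x T, evalPair x T m = 0 → MvPolynomial.eval x d ≠ 0 →
      ∀ i, evalPair x T (H i) * evalPair x T (H' i) = MvPolynomial.eval x d ^ 2) :
    ∃ x T, evalPair x T m = 0 ∧ MvPolynomial.eval x d ≠ 0 ∧ MvPolynomial.eval x q ≠ 0 ∧
      ∀ i, Complex.exp (x i) = evalPair x T (H i) / MvPolynomial.eval x d := by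
  obtain ⟨k, c, δ, t₀, hc, hδ, hlow⟩ := exists_lattice_direction (mul_ne_zero hd hq)
  set v : Fin n → ℂ := fun i => (k i : ℂ) * (2 * Real.pi * Complex.I) with hv
  let Z := {z : (Fin n → ℂ) × ℂ // evalPair z.1 z.2 m = 0}
  have hw : ∀ z : Z, 1 ≤ 1 + ‖z.1.1‖ := fun z => by linarith [norm_nonneg z.1.1]
  -- The factor `q` appears because only the product `|d| |q|` is bounded below: `|H/d| = |H| |q| /
  -- (|d| |q|)`.
  have hbound : PolyBounded (fun z : Z => 1 + ‖z.1.1‖) fun z =>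
      (∑ i, (‖evalPair z.1.1 z.1.2 (H i)‖ + ‖evalPair z.1.1 z.1.2 (H' i)‖)) *
        ‖MvPolynomial.eval z.1.1 q‖ :=
    (PolyBounded.sum hw _ fun i _ => (PolyBounded.evalPair hm (fun z : Z => z.2) (H i)).add hw
      (PolyBounded.evalPair hm (fun z : Z => z.2) (H' i))).mul hw (fun _ => norm_nonneg _)
      (PolyBounded.eval q)
  obtain ⟨C, N, hC, hCN⟩ := hbound
  -- The summand `1` makes `log A` nonnegative; `B` is chosen so that `1 + ‖x‖ ≤ B t` on the ball
  -- when `t ≥ 1`.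
  set A := C / δ + 1 with hA
  have hA1 : 1 ≤ A := by rw [hA]; linarith [div_nonneg hC hδ.le]
  set B := 1 + ‖v‖ + c with hB
  have hB1 : 1 ≤ B := by rw [hB]; linarith [norm_nonneg v]
  -- This is `40 ((M + 1) + 4) ≤ c t` for the `M` set below, with `log (B t)` expanded; `M + 1`
  -- serves as a strictly positive bound. Taking `t` in `ℕ` keeps `t v` in the lattice.
  obtain ⟨t, ht, htt₀, ht1⟩ : ∃ t : ℕ, (40 * (Real.log A + N * Real.log B + 1 + 4)) +
      (40 * N) * Real.log t ≤ c * t ∧ t₀ ≤ t ∧ 1 ≤ (t : ℝ) := by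
    have h1 := tendsto_natCast_atTop_atTop.eventually (eventually_const_add_mul_log_le
      (40 * (Real.log A + N * Real.log B + 1 + 4)) (40 * N) hc)
    have h2 := (tendsto_natCast_atTop_atTop (R := ℝ)).eventually (Filter.eventually_ge_atTop t₀)
    have h3 := (tendsto_natCast_atTop_atTop (R := ℝ)).eventually (Filter.eventually_ge_atTop 1)
    exact (h1.and (h2.and h3)).exists
  have ht0 : (0 : ℝ) < t := by linarith
  set U := Metric.ball ((t : ℝ) • v) (c * t) with hU
  have hlowU : ∀ x ∈ U, δ ≤ ‖MvPolynomial.eval x d‖ * ‖MvPolynomial.eval x q‖ := fun x hx => by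
    have h := hlow t htt₀ x (mem_ball_iff_norm.1 hx)
    rwa [map_mul, norm_mul] at h
  have hdU : ∀ x ∈ U, MvPolynomial.eval x d ≠ 0 := fun x hx h => by
    have := hlowU x hx
    rw [h, norm_zero, zero_mul] at this
    linarith
  have hqU : ∀ x ∈ U, MvPolynomial.eval x q ≠ 0 := fun x hx h => by
    have := hlowU x hx
    rw [h, norm_zero, mul_zero] at this
    linarith
  have hUn : U.Nonempty := ⟨_, Metric.mem_ball_self (by positivity)⟩
  obtain ⟨θ, hθ, hθs⟩ := exists_smooth_root hm hdeg Metric.isOpen_ball (convex_ball _ _) hUn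
    fun x hx T hT => hsep x T hT (hdU x hx)
  have hHne : ∀ x ∈ U, ∀ i, evalPair x (θ x) (H i) ≠ 0 := fun x hx i h => by
    have := hinv x _ (hθ x hx) (hdU x hx) i
    rw [h, zero_mul] at this
    exact pow_ne_zero 2 (hdU x hx) this.symm
  have hlog : ∀ i, ∃ l : (Fin n → ℂ) → ℂ,
      (∀ x ∈ U, Complex.exp (l x) = evalPair x (θ x) (H i) / MvPolynomial.eval x d) ∧
      ∀ x ∈ U, ContDiffAt ℂ 1 l x := fun i =>
    exists_smooth_log Metric.isOpen_ball (convex_ball _ _) hUn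
      (fun x hx => ((contDiff_evalPair (H i)).contDiffAt.comp x
        (contDiffAt_id.prodMk (hθs x hx))).div (contDiff_eval_mvPolynomial d).contDiffAt (hdU x hx))
      fun x hx => div_ne_zero (hHne x hx i) (hdU x hx)
  choose l hl hls using hlog
  have hnorm : ∀ x ∈ U, 1 + ‖x‖ ≤ B * t := fun x hx => by
    have h1 := mem_ball_iff_norm.1 hx
    have h2 : ‖x‖ ≤ ‖x - (t : ℝ) • v‖ + ‖(t : ℝ) • v‖ := by
      simpa using norm_add_le (x - (t : ℝ) • v) ((t : ℝ) • v)
    rw [norm_smul, Real.norm_eq_abs, abs_of_pos ht0] at h2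
    rw [hB]
    nlinarith
  set M := Real.log A + N * Real.log (B * t) with hM
  have hM0 : 0 ≤ M := add_nonneg (Real.log_nonneg hA1)
    (mul_nonneg (Nat.cast_nonneg _) (Real.log_nonneg (by nlinarith)))
  have hexpM : Real.exp M = A * (B * t) ^ N := by
    rw [hM, Real.exp_add, Real.exp_log (by positivity), Real.exp_nat_mul,
      Real.exp_log (by positivity)]
  have hquot : ∀ x ∈ U, ∀ p, (∃ i, p = H i ∨ p = H' i) →
      ‖evalPair x (θ x) p / MvPolynomial.eval x d‖ ≤ Real.exp M := fun x hx p ⟨i, hp⟩ => by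
    have h1 := hCN ⟨(x, θ x), hθ x hx⟩
    have h2 : ‖evalPair x (θ x) p‖ ≤
        ∑ i, (‖evalPair x (θ x) (H i)‖ + ‖evalPair x (θ x) (H' i)‖) := by
      refine le_trans ?_ (Finset.single_le_sum (f := fun i =>
        ‖evalPair x (θ x) (H i)‖ + ‖evalPair x (θ x) (H' i)‖)
        (fun i _ => by positivity) (Finset.mem_univ i))
      rcases hp with rfl | rfl
      · exact le_add_of_nonneg_right (norm_nonneg _)
      · exact le_add_of_nonneg_left (norm_nonneg _)
    have h3 : ‖evalPair x (θ x) p‖ * ‖MvPolynomial.eval x q‖ ≤ C * (B * t) ^ N := by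
      refine (mul_le_mul_of_nonneg_right h2 (norm_nonneg _)).trans (h1.trans ?_)
      have := hnorm x hx
      gcongr
    have hdpos := norm_pos_iff.2 (hdU x hx)
    have hqpos := norm_pos_iff.2 (hqU x hx)
    rw [norm_div, hexpM, div_le_iff₀ hdpos]
    refine le_of_mul_le_mul_right (h3.trans ?_) hqpos
    calc C * (B * t) ^ N = C / δ * (B * t) ^ N * δ := by field_simp
      _ ≤ A * (B * t) ^ N * (‖MvPolynomial.eval x d‖ * ‖MvPolynomial.eval x q‖) := by
        have := hlowU x hx
        have : C / δ ≤ A := by rw [hA]; linarith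
        gcongr
      _ = _ := by ring
  have hre : ∀ i, ∀ x ∈ U, |(l i x).re| ≤ M + 1 := fun i x hx => by
    have hne := hHne x hx i
    have hd0 := hdU x hx
    have h1 := hquot x hx (H i) ⟨i, Or.inl rfl⟩
    have h2 := hquot x hx (H' i) ⟨i, Or.inr rfl⟩
    have h3 : evalPair x (θ x) (H' i) / MvPolynomial.eval x d =
        (evalPair x (θ x) (H i) / MvPolynomial.eval x d)⁻¹ := by
      have := hinv x _ (hθ x hx) hd0 i
      field_simp
      rw [mul_comm, this]
    rw [h3, norm_inv, ← hl i x hx, Complex.norm_exp, ← Real.exp_neg, Real.exp_le_exp] at h2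
    rw [← hl i x hx, Complex.norm_exp, Real.exp_le_exp] at h1
    rw [abs_le]
    constructor <;> linarith
  obtain ⟨x, hx, hexp⟩ := exists_exp_eq_exp_mul_exp (a := (t : ℝ) • v) (M := M + 1) (by linarith)
    (by
      refine le_trans (le_of_eq ?_) ht
      rw [hM, Real.log_mul (by positivity) (by positivity)]
      ring)
    (fun i x hx => (hls i x hx).differentiableAt one_ne_zero) hre
  refine ⟨x, θ x, hθ x hx, hdU x hx, hqU x hx, fun i => ?_⟩
  have h1 : Complex.exp (((t : ℝ) • v) i) = 1 := by
    rw [Complex.exp_eq_one_iff]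
    refine ⟨t * k i, ?_⟩
    simp only [hv, Pi.smul_apply, Complex.real_smul]
    push_cast
    ring
  rw [hexp i, h1, one_mul, hl i x hx]

theorem mainTheorem10 (n : ℕ) (p : Fin n → Polynomial (MvPolynomial (Fin n) ℂ))
    (hirr : ∀ i, Irreducible (p i))
    (hdeg : ∀ i, 1 ≤ (p i).natDegree)
    (hu : ∀ i, ∀ c : ℂ, p i ≠ Polynomial.C (MvPolynomial.C c) * Polynomial.X)
    (V : Set (GPoints n)) (hV : IsIrreducibleComponentOf V (systemZeros p))
    (hdom : ZariskiDense (Prod.fst '' V)) :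
    ZariskiDense {a : Fin n → ℂ | expPoint a ∈ V} := by
  -- As `V` is closed in `G_n(ℂ)`, a point of `G_n(ℂ)` annihilated by its vanishing ideal lies in
  -- `V`; exponentials being nonzero, `expPoint x` is such a candidate.
  obtain ⟨S, hS⟩ := isClosed_zariskiTopologyG_iff.1 (hV.isClosed (isClosed_systemZeros p))
  obtain ⟨v, hv⟩ := hV.1.2.1
  have := isPrime_vanishingIdealG hV.1.2
  obtain ⟨m, d, H, H', hm, hmdeg, hd, hgen⟩ := exists_generic_parametrization (vanishingIdealG V)
    (fun f hf => by
      by_contra hf0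
      obtain ⟨_, ⟨g, hg, rfl⟩, hfg⟩ := zariskiDense_iff.1 hdom f hf0
      exact hfg ((eval_rename_inl g f).symm.trans (hf g hg)))
    (fun i hi => (v.2 i).ne_zero (by simpa [GPoints.toAffine] using hi v hv))
    (fun i => ⟨p i, (hirr i).ne_zero, fun g hg =>
      (eval_systemPoly i (p i) g).trans (hV.1.1 hg i)⟩)
  refine zariskiDense_iff.2 fun q hq => ?_
  obtain ⟨x, T, hT, hdx, hqx, hexp⟩ := exists_exp_eq_algebraic hm hmdeg hd hq
    (fun x T hT hdx => (hgen x T hT hdx).1) (fun x T hT hdx => (hgen x T hT hdx).2.1)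
  refine ⟨x, ?_, hqx⟩
  have hpt : (expPoint x).toAffine =
      Sum.elim x fun i => evalPair x T (H i) / MvPolynomial.eval x d := by
    funext j
    rcases j with i | i
    · rfl
    · exact hexp i
  change expPoint x ∈ V
  rw [hS]
  intro f hf
  rw [hpt]
  exact (hgen x T hT hdx).2.2 f fun g hg => by
    rw [hS] at hg
    exact hg f hf
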